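/- Let $F/\mathbb{F}_q$ be an algebraic function field of one variable over a finite field, let $S$ be a finite set of places of $F/\mathbb{F}_q$, and let $R$ be a place of $F/\mathbb{F}_q$ with $R\notin S$. Let $m\ge 1$ be an integer, and for each $P\in S$ let $N_P$ be a finite set of (distinct) positive integers such that $\sum_{f\in N_P} f=m$. Then there is a finite separable extension $E/F$ such that: (i) $[E:F]=m$, and $R$ is totally ramified in $E$, i.e. $R$ has exactly one extension $Q$ in $E$ and its ramification index is $e(Q|R)=m$; (ii) for each $P\in S$ and each $f\in N_P$ there is exactly one place $Q$ of $E$ lying above $P$ with relative degree $f(Q|P)=f$; (iii) there is $y\in E$ such that $E=F(y)$ and, for every $P\in S$, $\{1,y,\dots,y^{m-1}\}$ is an integral basis for $E/F$ at $P$, i.e. it is a basis of $E$ over $F$ and the integral closure in $E$ of the valuation ring $\mathcal{O}_P$ of $P$ equals $\sum_{i=0}^{m-1}\mathcal{O}_P\,y^i$. -/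

import Mathlib

universe u


/-- `F` is an algebraic function field (of one variable) over `K`: it is a finite extension of
`K(x)` for some `x ∈ F` that is transcendental over `K`. -/
def IsAlgFunctionField (K F : Type*) [Field K] [Field F] [Algebra K F] : Prop :=
  ∃ x : F, Transcendental K x ∧ FiniteDimensional (IntermediateField.adjoin K {x}) F

/-- A place of the function field `F / K`, given by its valuation ring `𝒪_P`, a proper valuation
subring of `F` containing `K`. (The place itself is the maximal ideal of this ring.) -/
@[ext]
structure Place (K F : Type*) [Field K] [Field F] [Algebra K F] where
  /-- the valuation ring `𝒪_P` -/
  ring : ValuationSubring F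
  algebraMap_mem : ∀ a : K, algebraMap K F a ∈ ring
  ne_top : ring ≠ ⊤

namespace Place

noncomputable section

variable {K F E : Type*} [Field K] [Field F] [Field E] [Algebra K F] [Algebra K E] [Algebra F E]

/-- The residue class field `k(P)`. -/
abbrev residueField (P : Place K F) : Type _ := IsLocalRing.ResidueField P.ring

/-- `Q | P`: the place `Q` of `E` is an extension of the place `P` of `F`, i.e. `Q ∩ F = P`,
in terms of valuation rings `𝒪_Q ∩ F = 𝒪_P`. -/
def LiesOver (Q : Place K E) (P : Place K F) : Prop :=
  Q.ring.comap (algebraMap F E) = P.ring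

namespace LiesOver

variable {Q : Place K E} {P : Place K F}

theorem mem_iff (h : Q.LiesOver P) (x : F) : algebraMap F E x ∈ Q.ring ↔ x ∈ P.ring := by
  rw [← ValuationSubring.mem_comap, show Q.ring.comap (algebraMap F E) = P.ring from h]

/-- The inclusion `𝒪_P → 𝒪_Q`. -/
def ringMap (h : Q.LiesOver P) : P.ring →+* Q.ring :=
  ((algebraMap F E).comp P.ring.subtype).codRestrict Q.ring fun x => (h.mem_iff x).2 x.2

theorem coe_ringMap (h : Q.LiesOver P) (x : P.ring) :
    (h.ringMap x : E) = algebraMap F E (x : F) := rfl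

theorem isLocalHom_ringMap (h : Q.LiesOver P) : IsLocalHom h.ringMap := by
  refine ⟨fun x hx => ?_⟩
  obtain ⟨z, hz⟩ := hx.exists_right_inv
  have hz' : algebraMap F E (x : F) * (z : E) = 1 := by
    have := congrArg (fun w : Q.ring => (w : E)) hz
    simpa [coe_ringMap] using this
  have hx0 : (x : F) ≠ 0 := by
    intro h0
    simp [h0] at hz'
  have hzi : algebraMap F E ((x : F)⁻¹) = (z : E) := by
    rw [map_inv₀]
    exact inv_eq_of_mul_eq_one_right hz'
  have hmem : (x : F)⁻¹ ∈ P.ring := (h.mem_iff _).1 (hzi ▸ z.2)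
  exact IsUnit.of_mul_eq_one ⟨(x : F)⁻¹, hmem⟩ (Subtype.ext (mul_inv_cancel₀ hx0))

/-- The induced embedding of residue class fields `k(P) → k(Q)`. -/
def residueMap (h : Q.LiesOver P) : P.residueField →+* Q.residueField :=
  haveI := h.isLocalHom_ringMap
  IsLocalRing.ResidueField.map h.ringMap

/-- The relative degree `f(Q|P) = [k(Q) : k(P)]`. -/
def relDegree (h : Q.LiesOver P) : ℕ :=
  letI : Algebra P.residueField Q.residueField := h.residueMap.toAlgebra
  Module.finrank P.residueField Q.residueField

/-- The ramification index `e(Q|P)`: the largest `n` such that the maximal ideal of `𝒪_P`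
is mapped into the `n`-th power of the maximal ideal of `𝒪_Q`. -/
def ramificationIndex (h : Q.LiesOver P) : ℕ :=
  sSup {n : ℕ | (IsLocalRing.maximalIdeal P.ring).map h.ringMap ≤
    IsLocalRing.maximalIdeal Q.ring ^ n}

end LiesOver

/-- `P` is totally ramified in `E / F`: it has exactly one extension `Q` in `E`, and
`e(Q|P) = [E : F]`. -/
def IsTotallyRamifiedIn (P : Place K F) (E : Type*) [Field E] [Algebra K E] [Algebra F E] : Prop :=
  ∃ (Q : Place K E) (h : Q.LiesOver P),
    (∀ Q' : Place K E, Q'.LiesOver P → Q' = Q) ∧ h.ramificationIndex = Module.finrank F E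

/-- The finite family `z` is an integral basis for `E / F` at `P`: it is a basis of the
`F`-vector space `E`, and the integral closure of `𝒪_P` in `E` is `∑ 𝒪_P • z i`. -/
def IsIntegralBasisAt (P : Place K F) {ι : Type*} (z : ι → E) : Prop :=
  LinearIndependent F z ∧ Submodule.span F (Set.range z) = ⊤ ∧
    Submodule.span P.ring (Set.range z) =
      Subalgebra.toSubmodule (integralClosure P.ring E)

end

end Place

/-! The extension is `E = F[X]/(Φ)`, where one monic `Φ` of degree `m` is chosen by weak
approximation to meet a local condition at each place. At `P ∈ S` it reduces to a product of monic
irreducibles over the finite field `k(P)`, one of each degree `f ∈ N P`; at `R` every lower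
coefficient is a uniformizer.

At `R` the polynomial is Eisenstein. This gives irreducibility, hence `[E : F] = m`, and total
ramification with `y` as uniformizer (`isTotallyRamifiedIn`). The linear coefficient, if `m > 1`, is
nonzero, so `Φ' ≠ 0` and `Φ` is separable.

At `P ∈ S` the factors have distinct degrees, so the reduction is squarefree and the Kummer–Dedekind
argument applies: each factor belongs to exactly one place, whose relative degree is the degree of
the factor (`existsUnique_relDegree_eq`), and the powers of `y` generate the integral closure
(`isIntegralBasisAt`).

Places are bare valuation rings, so their discreteness and the finiteness of their residue fields
are proved first (`isDiscreteValuationRing_and_finite`). -/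

namespace ValuationSubring

/-! ### Weak approximation for discrete valuation rings of a field -/

variable {F : Type*} [Field F]

/-- The archimedean property of a discrete valuation: the numerator of `c` is a unit times `ϖ ^ k`,
its denominator can only enlarge the value, and `ϖ` divides `z`. -/
theorem exists_pow_valuation_lt (A : ValuationSubring F) [IsDiscreteValuationRing A] {z c : F}
    (hz : A.valuation z < 1) (hc : c ≠ 0) :
    ∃ N : ℕ, ∀ n ≥ N, A.valuation z ^ n < A.valuation c := by
  obtain ⟨a, b, hb, rfl⟩ := IsFractionRing.div_surjective (A := A) c
  have ha : a ≠ 0 := by rintro rfl; simp at hc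
  have hb0 : b ≠ 0 := nonZeroDivisors.ne_zero hb
  obtain ⟨ϖ, hϖ⟩ := IsDiscreteValuationRing.exists_irreducible A
  obtain ⟨k, u, rfl⟩ := IsDiscreteValuationRing.eq_unit_mul_pow_irreducible ha hϖ
  have hzA : z ∈ A := A.mem_of_valuation_le_one _ hz.le
  have hzm : (⟨z, hzA⟩ : A) ∈ IsLocalRing.maximalIdeal A := (A.valuation_lt_one_iff _).2 hz
  rw [hϖ.maximalIdeal_eq, Ideal.mem_span_singleton] at hzm
  obtain ⟨w, hw⟩ := hzm
  have hzw : z = ϖ * w := congrArg Subtype.val hw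
  have hϖ1 : A.valuation ϖ < 1 := by
    rw [← A.valuation_lt_one_iff, hϖ.maximalIdeal_eq]
    exact Ideal.mem_span_singleton_self _
  have hϖ0 : 0 < A.valuation ϖ := by
    rw [zero_lt_iff, Valuation.ne_zero_iff]
    exact_mod_cast hϖ.ne_zero
  refine ⟨k + 1, fun n hn => ?_⟩
  have h1 : A.valuation z ≤ A.valuation ϖ := by
    rw [hzw, map_mul]
    exact mul_le_of_le_one_right' (A.valuation_le_one w)
  have hbv : 0 < A.valuation (b : F) := by
    rw [zero_lt_iff, Valuation.ne_zero_iff]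
    exact_mod_cast hb0
  calc A.valuation z ^ n ≤ A.valuation ϖ ^ n := pow_le_pow_left₀ zero_le h1 n
    _ ≤ A.valuation ϖ ^ (k + 1) := pow_le_pow_right_of_le_one' hϖ1.le hn
    _ < A.valuation ϖ ^ k := pow_lt_pow_right_of_lt_one₀ hϖ0 hϖ1 (Nat.lt_succ_self k)
    _ ≤ _ := by
      simp only [algebraMap_apply, map_div₀]
      rw [le_div_iff₀ hbv]
      push_cast
      rw [map_mul, map_pow, valuation_unit, one_mul]
      exact mul_le_of_le_one_right' (A.valuation_le_one b)

/-- In Krull dimension one no valuation ring lies strictly between `A` and `F`, so neither ring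
contains the other; a quotient of witnesses separates them. -/
theorem exists_valuation_lt_one_one_lt {A B : ValuationSubring F} [IsDiscreteValuationRing A]
    [IsDiscreteValuationRing B] (hA : A ≠ ⊤) (hB : B ≠ ⊤) (h : A ≠ B) :
    ∃ z : F, A.valuation z < 1 ∧ 1 < B.valuation z := by
  have key : ∀ A B : ValuationSubring F, IsDiscreteValuationRing A → B ≠ ⊤ → A ≠ B →
      ∃ a, a ∈ A ∧ a ∉ B := by
    intro A B _ hB h
    by_contra! hle
    have : Ring.KrullDimLE 1 A := inferInstance
    exact h (eq_of_le_of_ne_top A hle hB)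
  obtain ⟨a, haA, haB⟩ := key A B inferInstance hB h
  obtain ⟨b, hbB, hbA⟩ := key B A inferInstance hA h.symm
  rw [← valuation_le_one_iff] at haA haB hbA hbB
  push Not at haB hbA
  have hb0 : b ≠ 0 := by rintro rfl; simp at hbA
  refine ⟨a / b, ?_, ?_⟩ <;> rw [map_div₀]
  · exact (div_lt_one₀ (zero_lt_one.trans hbA)).2 (haA.trans_lt hbA)
  · have : 0 < B.valuation b := by simpa [zero_lt_iff] using hb0
    exact (one_lt_div₀ this).2 (hbB.trans_lt haB)

theorem exists_forall_one_lt_valuation (A : ValuationSubring F) (T : Finset (ValuationSubring F))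
    (hT : ∀ B ∈ T, ∃ z : F, A.valuation z < 1 ∧ 1 < B.valuation z) :
    ∃ z : F, A.valuation z < 1 ∧ ∀ B ∈ T, 1 < B.valuation z := by
  classical
  induction T using Finset.induction_on with
  | empty => exact ⟨0, by simp, by simp⟩
  | insert C T hC ih =>
    obtain ⟨z, hz, hzT⟩ := ih fun B hB => hT B (Finset.mem_insert_of_mem hB)
    obtain ⟨w, hw, hwC⟩ := hT C (Finset.mem_insert_self _ _)
    -- `z` may fail at `C`, so it is perturbed by a power of `w`. Each `B` excludes at most one
    -- exponent: two bad ones would bound `w ^ (s + 1) - w ^ (r + 1)`, or `z` itself when `w` is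
    -- integral at `B`.
    have bad : ∀ B ∈ insert C T, {r : ℕ | B.valuation (z + w ^ (r + 1)) ≤ 1}.Subsingleton := by
      have aux : ∀ B ∈ insert C T, ∀ r s : ℕ, r < s → B.valuation (z + w ^ (r + 1)) ≤ 1 →
          ¬ B.valuation (z + w ^ (s + 1)) ≤ 1 := by
        intro B hB r s hrs hr hs
        by_cases hwB : B.valuation w ≤ 1
        · have hBT : B ∈ T := by
            rcases Finset.mem_insert.1 hB with rfl | h
            · exact absurd hwC (not_lt.2 hwB)
            · exact h
          have : B.valuation z ≤ 1 := by
            have : z = (z + w ^ (r + 1)) - w ^ (r + 1) := by ring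
            rw [this]
            exact B.valuation.map_sub_le hr (by rw [map_pow]; exact pow_le_one' hwB _)
          exact absurd (hzT B hBT) (not_lt.2 this)
        · push Not at hwB
          have h1 : B.valuation (w ^ (s + 1) - w ^ (r + 1)) ≤ 1 := by
            have : w ^ (s + 1) - w ^ (r + 1) = (z + w ^ (s + 1)) - (z + w ^ (r + 1)) := by ring
            rw [this]
            exact B.valuation.map_sub_le hs hr
          have hlt : B.valuation (w ^ (r + 1)) < B.valuation (w ^ (s + 1)) := by
            rw [map_pow, map_pow]
            exact pow_lt_pow_right₀ hwB (by omega)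
          rw [B.valuation.map_sub_eq_of_lt_left hlt, map_pow] at h1
          exact absurd h1 (not_le.2 (one_lt_pow₀ hwB (by omega)))
      intro B hB r hr s hs
      by_contra hne
      rcases lt_or_gt_of_ne hne with h | h
      · exact aux B hB r s h hr hs
      · exact aux B hB s r h hs hr
    have hfin : (⋃ B ∈ insert C T, {r : ℕ | B.valuation (z + w ^ (r + 1)) ≤ 1}).Finite :=
      (Finset.finite_toSet (insert C T)).biUnion fun B hB => (bad B hB).finite
    obtain ⟨r, hr⟩ := hfin.exists_notMem
    simp only [Set.mem_iUnion, not_exists, Set.mem_ofPred_eq, not_le] at hr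
    refine ⟨z + w ^ (r + 1), A.valuation.map_add_lt hz ?_, hr⟩
    rw [map_pow]
    exact pow_lt_one₀ zero_le hw (by omega)

/-- If `z` is small at `A` and large at the other rings, then `a / (1 + z ^ n)` tends to `a` at `A`
and to `0` elsewhere; summing over `A` solves all conditions at once. -/
theorem exists_valuation_sub_lt (T : Finset (ValuationSubring F))
    (hT : ∀ A ∈ T, IsDiscreteValuationRing A) (htop : ∀ A ∈ T, A ≠ ⊤)
    (a c : ValuationSubring F → F) (hc : ∀ A ∈ T, c A ≠ 0) :
    ∃ x : F, ∀ A ∈ T, A.valuation (x - a A) < A.valuation (c A) := by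
  classical
  have step : ∀ A ∈ T, ∃ x : F, A.valuation (x - a A) < A.valuation (c A) ∧
      ∀ B ∈ T, B ≠ A → B.valuation x < B.valuation (c B) := by
    intro A hA
    have := hT A hA
    obtain ⟨z, hz, hzT⟩ := exists_forall_one_lt_valuation A (T.erase A) (by
      intro B hB
      have hB' := Finset.mem_of_mem_erase hB
      have := hT B hB'
      exact exists_valuation_lt_one_one_lt (htop A hA) (htop B hB')
        (Finset.ne_of_mem_erase hB).symm)
    by_cases ha : a A = 0
    · refine ⟨0, ?_, fun B hB _ => ?_⟩
      · simpa [ha, zero_lt_iff] using hc A hA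
      · simpa [zero_lt_iff] using hc B hB
    have hNA := exists_pow_valuation_lt A hz (div_ne_zero (hc A hA) ha)
    have hNB : ∀ B ∈ T.erase A, ∃ N : ℕ, ∀ n ≥ N,
        B.valuation z⁻¹ ^ n < B.valuation (c B / a A) := by
      intro B hB
      have hB' := Finset.mem_of_mem_erase hB
      have := hT B hB'
      refine exists_pow_valuation_lt B ?_ (div_ne_zero (hc B hB') ha)
      rw [map_inv₀]
      exact inv_lt_one_of_one_lt₀ (hzT B hB)
    obtain ⟨NA, hNA⟩ := hNA
    choose! NB hNB using hNB
    set n := NA + (T.erase A).sup NB + 1 with hn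
    have hzn : A.valuation (z ^ n) < 1 := by
      rw [map_pow]; exact pow_lt_one₀ zero_le hz (by omega)
    have h1 : A.valuation (1 + z ^ n) = 1 := A.valuation.map_one_add_of_lt hzn
    have h0 : 1 + z ^ n ≠ 0 := by
      intro h; rw [h, map_zero] at h1; exact zero_ne_one h1
    have hav : ∀ B : ValuationSubring F, 0 < B.valuation (a A) := fun B => by
      simpa [zero_lt_iff] using ha
    refine ⟨a A / (1 + z ^ n), ?_, fun B hB hBA => ?_⟩
    · have : a A / (1 + z ^ n) - a A = - (a A * z ^ n / (1 + z ^ n)) := by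
        field_simp; ring
      rw [this, Valuation.map_neg, map_div₀, h1, div_one, map_mul, map_pow]
      have := hNA n (by omega)
      rw [map_div₀, lt_div_iff₀ (hav A)] at this
      rwa [mul_comm]
    · have hBe : B ∈ T.erase A := Finset.mem_erase.2 ⟨hBA, hB⟩
      have hzB : 1 < B.valuation (z ^ n) := by
        rw [map_pow]; exact one_lt_pow₀ (hzT B hBe) (by omega)
      have h2 : B.valuation (1 + z ^ n) = B.valuation z ^ n := by
        rw [← map_pow]
        apply B.valuation.map_add_eq_of_lt_right
        rwa [map_one]
      rw [map_div₀, h2]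
      have hle : NB B ≤ (T.erase A).sup NB := Finset.le_sup hBe
      have := hNB B hBe n (by omega)
      rw [map_div₀, lt_div_iff₀ (hav B), map_inv₀, inv_pow] at this
      rwa [div_eq_mul_inv, mul_comm]
  choose! x hx hxB using step
  refine ⟨∑ A ∈ T, x A, fun A hA => ?_⟩
  have : ∑ B ∈ T, x B - a A = (x A - a A) + ∑ B ∈ T.erase A, x B := by
    rw [← Finset.add_sum_erase T x hA]; ring
  rw [this]
  refine A.valuation.map_add_lt (hx A hA) (A.valuation.map_sum_lt ?_ fun B hB => ?_)
  · simpa using hc A hA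
  · exact hxB B (Finset.mem_of_mem_erase hB) A hA (Finset.ne_of_mem_erase hB).symm

end ValuationSubring

/-! ### Places of a function field over a finite field are discrete with finite residue field -/

open Polynomial

section

variable {K F : Type*} [Field K] [Field F] [Algebra K F]

open IntermediateField.algebraAdjoinAdjoin in
theorem exists_polynomial_relation (x : F)
    [FiniteDimensional (IntermediateField.adjoin K {x}) F]
    (w : Fin (Module.finrank (IntermediateField.adjoin K {x}) F + 1) → F) :
    ∃ q : Fin (Module.finrank (IntermediateField.adjoin K {x}) F + 1) → K[X],
      q ≠ 0 ∧ ∑ i, aeval x (q i) * w i = 0 := by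
  have h : ¬ LinearIndependent (IntermediateField.adjoin K {x}) w := by
    intro h
    have := h.fintype_card_le_finrank
    simp at this
  rw [← LinearIndependent.iff_fractionRing (R := Algebra.adjoin K {x}),
    Fintype.not_linearIndependent_iff] at h
  obtain ⟨d, hd, i, hi⟩ := h
  have hq : ∀ i, ∃ q : K[X], aeval x q = (d i : F) := by
    intro i
    exact (Algebra.adjoin_singleton_eq_range_aeval K x).le (d i).2
  choose q hq using hq
  refine ⟨q, fun h0 => hi ?_, ?_⟩
  · ext
    rw [← hq i, h0]
    simp
  · simpa [hq, Algebra.smul_def] using hd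

/-- The quotient has dimension at most `n` over the finite field `K[X]/(p)`: a relation between
lifts of `n + 1` elements, divided by the gcd of its coefficients, stays nontrivial modulo `p`. -/
theorem finite_quotient_span_algebraMap [Finite K] {O : Type*} [CommRing O] [IsDomain O]
    [Algebra K[X] O] (hinj : Function.Injective (algebraMap K[X] O)) {n : ℕ}
    (hrel : ∀ w : Fin (n + 1) → O, ∃ q : Fin (n + 1) → K[X], q ≠ 0 ∧ ∑ i, q i • w i = 0)
    {p : K[X]} (hp : Irreducible p) (hpm : p.Monic) :
    Finite (O ⧸ Ideal.span {algebraMap K[X] O p}) := by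
  classical
  set I : Ideal K[X] := Ideal.span {p}
  set J : Ideal O := Ideal.span {algebraMap K[X] O p}
  have hIJ : I ≤ J.comap (algebraMap K[X] O) := by
    rw [Ideal.span_singleton_le_iff_mem, Ideal.mem_comap]
    exact Ideal.mem_span_singleton_self _
  let : Algebra (K[X] ⧸ I) (O ⧸ J) := Ideal.Quotient.algebraQuotientOfLEComap hIJ
  have hmax : I.IsMaximal := PrincipalIdealRing.isMaximal_of_irreducible hp
  let : Field (K[X] ⧸ I) := Ideal.Quotient.field I
  have hfk : Finite (K[X] ⧸ I) := by
    have := hpm.finite_quotient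
    exact Module.finite_of_finite K
  have hr : Module.rank (K[X] ⧸ I) (O ⧸ J) ≤ n := by
    refine rank_le fun s hs => ?_
    by_contra! hcard
    obtain ⟨e⟩ : Nonempty (Fin (n + 1) ↪ s) :=
      Function.Embedding.nonempty_of_card_le (by simpa using hcard)
    have hli := hs.comp e e.injective
    choose w hw using fun i => Ideal.Quotient.mk_surjective (e i : O ⧸ J)
    obtain ⟨q, hq0, hq⟩ := hrel w
    obtain ⟨g, hg, hg1⟩ := Finset.extract_gcd (s := Finset.univ) q Finset.univ_nonempty
    set c := Finset.univ.gcd q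
    have hc : c ≠ 0 := by
      intro h
      apply hq0
      ext1 i
      simp [hg i (Finset.mem_univ i), h]
    have hgw : ∑ i, g i • w i = 0 := by
      have : algebraMap K[X] O c * ∑ i, g i • w i = 0 := by
        rw [← hq, Finset.mul_sum]
        refine Finset.sum_congr rfl fun i _ => ?_
        rw [hg i (Finset.mem_univ i), Algebra.smul_def, Algebra.smul_def, map_mul, mul_assoc]
      refine (mul_eq_zero.1 this).resolve_left fun h => hc (hinj (by simpa using h))
    have hzero : ∀ i, Ideal.Quotient.mk I (g i) = 0 := by
      refine Fintype.linearIndependent_iff.1 hli (fun i => Ideal.Quotient.mk I (g i)) ?_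
      have := congrArg (Ideal.Quotient.mk J) hgw
      rw [map_sum, map_zero] at this
      rw [← this]
      refine Finset.sum_congr rfl fun i _ => ?_
      rw [Algebra.smul_def, Algebra.smul_def, map_mul, hw]
      rfl
    have : p ∣ Finset.univ.gcd g := Finset.dvd_gcd fun i _ => by
      rw [← Ideal.mem_span_singleton]
      exact Ideal.Quotient.eq_zero_iff_mem.1 (hzero i)
    rw [hg1] at this
    exact hp.not_isUnit (isUnit_of_dvd_one this)
  have : Module.Finite (K[X] ⧸ I) (O ⧸ J) := by
    rw [← Module.rank_lt_aleph0_iff]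
    exact hr.trans_lt (Cardinal.natCast_lt_aleph0)
  exact Module.finite_of_finite (K[X] ⧸ I)

theorem IsAlgFunctionField.exists_transcendental_mem (hF : IsAlgFunctionField K F)
    (P : Place K F) : ∃ x : F, x ∈ P.ring ∧ Transcendental K x ∧
      FiniteDimensional (IntermediateField.adjoin K {x}) F := by
  obtain ⟨x, hx, hfin⟩ := hF
  rcases P.ring.mem_or_inv_mem x with h | h
  · exact ⟨x, h, hx, hfin⟩
  · refine ⟨x⁻¹, h, fun h => hx (by simpa using h.inv), ?_⟩
    have : IntermediateField.adjoin K {x⁻¹} = IntermediateField.adjoin K {x} := by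
      apply le_antisymm <;> rw [IntermediateField.adjoin_simple_le_iff]
      · exact inv_mem (IntermediateField.mem_adjoin_simple_self K x)
      · simpa using inv_mem (IntermediateField.mem_adjoin_simple_self K x⁻¹)
    rwa [this]

/-- The maximal ideal contracts to some `(p)` in `K[X]`; put `π = p(x)`. A nonzero element of `𝒪_P`
divides a nonzero polynomial in `x`, whose part prime to `p` is a unit, so it divides a power of
`π`. As `𝒪_P/(π ^ k)` is finite, `𝒪_P` is Noetherian, and a Noetherian valuation ring that is not a
field is discrete. -/
theorem IsAlgFunctionField.isDiscreteValuationRing_and_finite [Finite K]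
    (hF : IsAlgFunctionField K F) (P : Place K F) :
    IsDiscreteValuationRing P.ring ∧ Finite P.residueField := by
  obtain ⟨x, hxP, hx, hfin⟩ := hF.exists_transcendental_mem P
  set O := P.ring with hO
  let : Algebra K O := ((algebraMap K F).codRestrict O P.algebraMap_mem).toAlgebra
  have : IsScalarTower K O F := IsScalarTower.of_algebraMap_eq fun _ => rfl
  let : Algebra K[X] O := (aeval (R := K) (⟨x, hxP⟩ : O)).toAlgebra
  have hmap : ∀ q : K[X], (algebraMap K[X] O q : F) = aeval x q := fun q => by
    change algebraMap O F (aeval (⟨x, hxP⟩ : O) q) = _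
    rw [← aeval_algebraMap_apply]
    rfl
  have hinj : Function.Injective (algebraMap K[X] O) := by
    rw [injective_iff_map_eq_zero]
    intro q hq
    by_contra h0
    exact hx ⟨q, h0, by rw [← hmap, hq]; rfl⟩
  set n := Module.finrank (IntermediateField.adjoin K {x}) F
  have hrel : ∀ w : Fin (n + 1) → O, ∃ q : Fin (n + 1) → K[X], q ≠ 0 ∧ ∑ i, q i • w i = 0 := by
    intro w
    obtain ⟨q, hq, h⟩ := exists_polynomial_relation x fun i => (w i : F)
    refine ⟨q, hq, Subtype.ext ?_⟩
    simpa [Algebra.smul_def, hmap] using h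
  have halg : ∀ a : O, IsAlgebraic K[X] a := by
    intro a
    obtain ⟨q, hq, h⟩ := hrel fun i => a ^ (i : ℕ)
    refine ⟨∑ i, C (q i) * X ^ (i : ℕ), fun h0 => hq ?_, ?_⟩
    · ext1 i
      have := congrArg (fun r => r.coeff (i : ℕ)) h0
      simpa [finsetSum_coeff, coeff_C_mul, coeff_X_pow, Fin.val_inj] using this
    · simpa [Algebra.smul_def] using h
  set 𝔪 := IsLocalRing.maximalIdeal O
  have hnf : ¬ IsField O := by
    intro h
    apply P.ne_top
    ext y
    simp only [ValuationSubring.mem_top, iff_true]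
    rcases O.mem_or_inv_mem y with hy | hy
    · exact hy
    · by_cases hy0 : y = 0
      · rw [hy0]; exact O.zero_mem
      obtain ⟨z, hz⟩ := h.mul_inv_cancel (a := ⟨y⁻¹, hy⟩) fun h => by
        have := congrArg Subtype.val h
        simp at this
        exact hy0 this
      have hz' : y⁻¹ * z = 1 := congrArg Subtype.val hz
      have : y = z := by field_simp at hz'; exact hz'.symm
      rw [this]
      exact z.2
  have hdvd : ∀ a : O, a ≠ 0 → ∃ r : K[X], r ≠ 0 ∧ a ∣ algebraMap K[X] O r := fun a ha =>
    (halg a).exists_nonzero_dvd (mem_nonZeroDivisors_of_ne_zero ha)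
  obtain ⟨a, ham, ha0⟩ := Submodule.exists_mem_ne_zero_of_ne_bot
    (mt IsLocalRing.isField_iff_maximalIdeal_eq.2 hnf)
  obtain ⟨r, hr0, har⟩ := hdvd a ha0
  have hcomap0 : 𝔪.comap (algebraMap K[X] O) ≠ ⊥ := fun h => hr0 <| by
    have : r ∈ 𝔪.comap (algebraMap K[X] O) := Ideal.mem_comap.2 (Ideal.mem_of_dvd _ har ham)
    rwa [h] at this
  obtain ⟨p, hp, hpm, hcomap⟩ : ∃ p : K[X], Irreducible p ∧ p.Monic ∧
      𝔪.comap (algebraMap K[X] O) = Ideal.span {p} := by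
    classical
    obtain ⟨p, hp⟩ := (IsPrincipalIdealRing.principal (𝔪.comap (algebraMap K[X] O))).principal
    have hp : 𝔪.comap (algebraMap K[X] O) = Ideal.span {p} := hp
    have hp0 : p ≠ 0 := by rintro rfl; exact hcomap0 (by simpa using hp)
    have hspan : Ideal.span {p} = Ideal.span {normalize p} := by
      rw [Ideal.span_singleton_eq_span_singleton]
      exact (normalize_associated p).symm
    refine ⟨normalize p, ?_, monic_normalize hp0, hp.trans hspan⟩
    have hprime : (Ideal.span {p}).IsPrime := hp ▸ inferInstance
    exact (normalize_associated p).symm.irreducible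
      ((Ideal.span_singleton_prime hp0).1 hprime).irreducible
  set π := algebraMap K[X] O p
  have hfinπ : Finite (O ⧸ Ideal.span {π}) := finite_quotient_span_algebraMap hinj hrel hp hpm
  have hπm : Ideal.span {π} ≤ 𝔪 := by
    rw [Ideal.span_singleton_le_iff_mem, ← Ideal.mem_comap, hcomap]
    exact Ideal.mem_span_singleton_self _
  have hpow : ∀ a : O, a ≠ 0 → ∃ k : ℕ, a ∣ π ^ k := by
    intro a ha
    obtain ⟨r, hr0, har⟩ := hdvd a ha
    obtain ⟨k, c, hc, hrc⟩ := WfDvdMonoid.max_power_factor hr0 hp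
    refine ⟨k, ?_⟩
    have hu : IsUnit (algebraMap K[X] O c) := by
      by_contra h
      have : c ∈ 𝔪.comap (algebraMap K[X] O) := h
      rw [hcomap, Ideal.mem_span_singleton] at this
      exact hc this
    rw [hrc, map_mul, map_pow] at har
    exact (hu.dvd_mul_right).1 har
  have hnoeth : IsNoetherianRing O := by
    rw [isNoetherianRing_iff_ideal_fg]
    intro I
    by_cases hI : I = ⊥
    · rw [hI]; exact Submodule.fg_bot
    obtain ⟨a, haI, ha0⟩ := Submodule.exists_mem_ne_zero_of_ne_bot hI
    obtain ⟨k, hk⟩ := hpow a ha0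
    have : Finite (O ⧸ Ideal.span {π} ^ k) :=
      Ideal.finite_quotient_pow (Submodule.fg_span_singleton _) k
    have hkI : Ideal.span {π} ^ k ≤ I := by
      rw [Ideal.span_singleton_pow, Ideal.span_singleton_le_iff_mem]
      exact Ideal.mem_of_dvd _ hk haI
    -- `I` contains the principal ideal `(π ^ k)`, and its image in the finite quotient is finitely
    -- generated.
    refine Submodule.fg_of_fg_map_of_fg_inf_ker (Ideal.span {π} ^ k).mkQ ?_ ?_
    · exact IsNoetherian.noetherian _
    · rw [Submodule.ker_mkQ, inf_eq_right.2 hkI, Ideal.span_singleton_pow]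
      exact Submodule.fg_span_singleton _
  refine ⟨?_, ?_⟩
  · have : IsPrincipalIdealRing O := inferInstance
    exact { not_a_field' := mt IsLocalRing.isField_iff_maximalIdeal_eq.2 hnf }
  · exact Finite.of_surjective _ (Ideal.Quotient.factor_surjective hπm)

end

/-! ### Content and reduction of polynomials over a valuation ring -/

theorem ValuationSubring.exists_eq_C_mul_map {F : Type*} [Field F] (A : ValuationSubring F)
    {G : F[X]} (hG : G ≠ 0) : ∃ (c : F) (D : A[X]), c ≠ 0 ∧ G = C c * D.map (algebraMap A F) ∧
      D.map (IsLocalRing.residue A) ≠ 0 := by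
  -- The content is a coefficient of largest valuation; dividing by it leaves integral coefficients,
  -- one of them equal to 1.
  obtain ⟨i, hi, hmax⟩ := Finset.exists_max_image G.support (fun i => A.valuation (G.coeff i))
    (nonempty_support_iff.2 hG)
  have hc : G.coeff i ≠ 0 := mem_support_iff.1 hi
  have hpos : 0 < A.valuation (G.coeff i) := by simpa [zero_lt_iff] using hc
  have hlift : C (G.coeff i)⁻¹ * G ∈ lifts (algebraMap A F) := by
    rw [lifts_iff_coeff_lifts]
    intro j
    refine ⟨⟨(C (G.coeff i)⁻¹ * G).coeff j, ?_⟩, rfl⟩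
    rw [← A.valuation_le_one_iff, coeff_C_mul, map_mul, map_inv₀, inv_mul_le_one₀ hpos]
    by_cases hj : j ∈ G.support
    · exact hmax j hj
    · rw [notMem_support_iff.1 hj, map_zero]; exact zero_le
  obtain ⟨D, hD⟩ := hlift
  have hD : D.map (algebraMap A F) = C (G.coeff i)⁻¹ * G := hD
  refine ⟨G.coeff i, D, hc, ?_, fun h0 => ?_⟩
  · rw [hD, ← mul_assoc, ← C_mul, mul_inv_cancel₀ hc, C_1, one_mul]
  · have h1 : algebraMap A F (D.coeff i) = 1 := by
      rw [← coeff_map, hD, coeff_C_mul, inv_mul_cancel₀ hc]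
    have h2 : D.coeff i = 1 := by
      apply IsFractionRing.injective A F; rw [h1, map_one]
    have := congrArg (fun r => r.coeff i) h0
    simp [coeff_map, h2] at this

theorem IsDiscreteValuationRing.exists_eq_C_mul_of_map_residue_eq_zero {A : Type*} [CommRing A]
    [IsDomain A] [IsDiscreteValuationRing A] {t : A} (ht : Irreducible t) {D : A[X]}
    (hD : D.map (IsLocalRing.residue A) = 0) : ∃ D' : A[X], D = C t * D' := by
  change C t ∣ D
  rw [C_dvd_iff_dvd_coeff]
  intro i
  rw [← Ideal.mem_span_singleton, ← ht.maximalIdeal_eq, ← IsLocalRing.residue_eq_zero_iff,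
    ← coeff_map, hD, coeff_zero]

/-! ### Places above `P` and the reduction of `y` -/

namespace Place

variable {K F E : Type*} [Field K] [Field F] [Field E] [Algebra K F] [Algebra K E] [Algebra F E]

namespace LiesOver

variable {Q : Place K E} {P : Place K F}

theorem algebraMap_mem_nonunits_iff (h : Q.LiesOver P) (a : F) :
    algebraMap F E a ∈ Q.ring.nonunits ↔ a ∈ P.ring.nonunits := by
  rw [ValuationSubring.mem_nonunits_iff_or, ValuationSubring.mem_nonunits_iff_or, ← map_inv₀,
    h.mem_iff, map_eq_zero]

theorem valuation_algebraMap_le_one_iff (h : Q.LiesOver P) (a : F) :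
    Q.ring.valuation (algebraMap F E a) ≤ 1 ↔ a ∈ P.ring := by
  rw [ValuationSubring.valuation_le_one_iff, h.mem_iff]

theorem mem_of_isIntegral (h : Q.LiesOver P) {x : E} (hx : IsIntegral P.ring x) : x ∈ Q.ring := by
  obtain ⟨f, hf, hfx⟩ := hx
  have : IsIntegral Q.ring x := by
    refine ⟨f.map h.ringMap, hf.map _, ?_⟩
    rw [eval₂_map]
    exact hfx
  obtain ⟨z, hz⟩ := IsIntegrallyClosed.isIntegral_iff.1 this
  rw [← hz]
  exact z.2

theorem aeval_mem (h : Q.LiesOver P) {y : E} (hy : y ∈ Q.ring) (D : P.ring[X]) :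
    aeval y D ∈ Q.ring := by
  rw [aeval_eq_sum_range]
  refine sum_mem fun i _ => ?_
  rw [Algebra.smul_def]
  exact Q.ring.mul_mem _ _ ((h.mem_iff _).2 (D.coeff i).2) (pow_mem hy i)

theorem residue_aeval (h : Q.LiesOver P) {y : E} (hy : y ∈ Q.ring) (D : P.ring[X]) :
    IsLocalRing.residue Q.ring ⟨aeval y D, h.aeval_mem hy D⟩ =
      (D.map (IsLocalRing.residue P.ring)).eval₂ h.residueMap
        (IsLocalRing.residue Q.ring ⟨y, hy⟩) := by
  have h1 : (⟨aeval y D, h.aeval_mem hy D⟩ : Q.ring) = D.eval₂ h.ringMap ⟨y, hy⟩ := by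
    apply Q.ring.subtype_injective
    rw [hom_eval₂]
    rfl
  rw [h1, hom_eval₂, eval₂_map]
  rfl

/-- The residue class of `y` at `Q` generates the extension of `k(P)` with the polynomial `p`:
a polynomial expression in `y` vanishes at `Q` exactly if its reduction is divisible by `p`. -/
def IsCenteredAt (_ : Q.LiesOver P) (y : E) (p : P.residueField[X]) : Prop :=
  ∀ D : P.ring[X], aeval y D ∈ Q.ring ∧
    (aeval y D ∈ Q.ring.nonunits ↔ p ∣ D.map (IsLocalRing.residue P.ring))

theorem isCenteredAt_iff (h : Q.LiesOver P) {y : E} (hy : y ∈ Q.ring) {p : P.residueField[X]}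
    (hp : Irreducible p) : h.IsCenteredAt y p ↔
      p.eval₂ h.residueMap (IsLocalRing.residue Q.ring ⟨y, hy⟩) = 0 := by
  have hnon : ∀ D : P.ring[X], aeval y D ∈ Q.ring.nonunits ↔
      (D.map (IsLocalRing.residue P.ring)).eval₂ h.residueMap
        (IsLocalRing.residue Q.ring ⟨y, hy⟩) = 0 := by
    intro D
    rw [← h.residue_aeval hy, IsLocalRing.residue_eq_zero_iff,
      ← ValuationSubring.coe_mem_nonunits_iff]
  constructor
  · intro hc
    obtain ⟨D, rfl⟩ := map_surjective _ IsLocalRing.residue_surjective p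
    rw [← hnon, (hc D).2]
  · refine fun h0 D => ⟨h.aeval_mem hy D, ?_⟩
    rw [hnon]
    refine ⟨fun hD => ?_, fun hD => eval₂_eq_zero_of_dvd_of_eval₂_eq_zero _ _ hD h0⟩
    by_contra hdvd
    obtain ⟨a, b, hab⟩ := (hp.coprime_iff_not_dvd).2 hdvd
    have := congrArg (eval₂ h.residueMap (IsLocalRing.residue Q.ring ⟨y, hy⟩)) hab
    simp [eval₂_add, eval₂_mul, h0, hD] at this

end LiesOver

variable [IsScalarTower K F E]

/-- Chevalley's extension theorem for the subring `𝒪_P[y]` and the ideal of all `D(y)` with `p`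
dividing the reduction of `D`; `hker` makes this ideal proper. -/
theorem exists_isCenteredAt (P : Place K F) {y : E} {p : P.residueField[X]} (hp : Irreducible p)
    (hker : ∀ D : P.ring[X], aeval y D = 0 → p ∣ D.map (IsLocalRing.residue P.ring)) :
    ∃ (Q : Place K E) (h : Q.LiesOver P), h.IsCenteredAt y p := by
  set J : Ideal P.ring[X] := (Ideal.span {p}).comap (mapRingHom (IsLocalRing.residue P.ring))
  have hJmem : ∀ D, D ∈ J ↔ p ∣ D.map (IsLocalRing.residue P.ring) := fun D => by
    rw [Ideal.mem_comap, Ideal.mem_span_singleton, coe_mapRingHom]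
  set A : Subring E := (aeval (R := P.ring) y).toRingHom.range
  set g : P.ring[X] →+* A := (aeval (R := P.ring) y).toRingHom.rangeRestrict
  have hgs : Function.Surjective g := RingHom.rangeRestrict_surjective _
  have hg : ∀ D, (g D : E) = aeval y D := fun _ => rfl
  have hI : J.map g ≠ ⊤ := by
    rw [Ideal.ne_top_iff_one, Ideal.mem_map_iff_of_surjective g hgs]
    rintro ⟨D, hD, h1⟩
    have hD1 : aeval y (1 - D) = 0 := by
      rw [map_sub, map_one, ← hg D, h1]
      simp
    have h2 := hker _ hD1
    rw [hJmem] at hD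
    rw [Polynomial.map_sub, Polynomial.map_one] at h2
    exact hp.not_isUnit (isUnit_of_dvd_one ((dvd_sub_left hD).1 h2))
  obtain ⟨B, hAB, hIB⟩ := Ideal.image_subset_nonunits_valuationSubring _ hI
  have hmem : ∀ D : P.ring[X], aeval y D ∈ B := fun D => hAB ⟨D, rfl⟩
  have hnon : ∀ D : P.ring[X], p ∣ D.map (IsLocalRing.residue P.ring) →
      aeval y D ∈ B.nonunits := fun D hD =>
    hIB ⟨g D, Ideal.mem_map_of_mem g ((hJmem D).2 hD), rfl⟩
  have hC : ∀ a : P.ring, algebraMap F E a ∈ B := fun a => by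
    have := hmem (C a)
    rwa [aeval_C] at this
  have hover : B.comap (algebraMap F E) = P.ring := by
    ext a
    rw [ValuationSubring.mem_comap]
    refine ⟨fun ha => ?_, fun ha => hC ⟨a, ha⟩⟩
    by_contra haP
    have ha' : a⁻¹ ∈ P.ring.nonunits := (ValuationSubring.inv_mem_nonunits_iff _).2 (Or.inr haP)
    have haP' : a⁻¹ ∈ P.ring := P.ring.nonunits_subset ha'
    have h1 : aeval y (C (⟨a⁻¹, haP'⟩ : P.ring)) ∈ B.nonunits := by
      apply hnon
      rw [map_C, (IsLocalRing.residue_eq_zero_iff _).2 (ValuationSubring.coe_mem_nonunits_iff.1 ha'),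
        C_0]
      exact dvd_zero _
    rw [aeval_C] at h1
    have h1 : algebraMap F E a⁻¹ ∈ B.nonunits := h1
    rw [map_inv₀, ValuationSubring.inv_mem_nonunits_iff] at h1
    rcases h1 with h1 | h1
    · rw [map_eq_zero] at h1
      exact haP (h1 ▸ P.ring.zero_mem)
    · exact h1 ha
  let Q : Place K E :=
    { ring := B
      algebraMap_mem := fun a => by
        rw [IsScalarTower.algebraMap_apply K F E]
        exact hC ⟨_, P.algebraMap_mem a⟩
      ne_top := by
        rintro rfl
        apply P.ne_top
        rw [← hover]
        ext; simp }
  have hQ : Q.LiesOver P := hover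
  have hy : y ∈ Q.ring := by simpa using hmem X
  refine ⟨Q, hQ, (hQ.isCenteredAt_iff hy hp).2 ?_⟩
  obtain ⟨D, rfl⟩ := map_surjective _ IsLocalRing.residue_surjective p
  rw [← hQ.residue_aeval hy, IsLocalRing.residue_eq_zero_iff,
    ← ValuationSubring.coe_mem_nonunits_iff]
  exact hnon D dvd_rfl

end Place

/-! ### Generators with minimal polynomial over `𝒪_P` -/

namespace Place

variable {K F E : Type*} [Field K] [Field F] [Field E] [Algebra K F] [Algebra F E]

/-- `y` generates `E / F`, and `φ` is its minimal polynomial, with coefficients in `𝒪_P`. -/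
structure IsGenerator (P : Place K F) (y : E) (φ : P.ring[X]) : Prop where
  monic : φ.Monic
  map_eq : φ.map (algebraMap P.ring F) = minpoly F y
  adjoin_eq_top : IntermediateField.adjoin F {y} = ⊤

namespace IsGenerator

variable {P : Place K F} {y : E} {φ : P.ring[X]}

theorem aeval_eq_zero (hg : P.IsGenerator y φ) : aeval y φ = 0 := by
  rw [← aeval_map_algebraMap F, hg.map_eq, minpoly.aeval]

theorem isIntegral (hg : P.IsGenerator y φ) : IsIntegral P.ring y :=
  ⟨φ, hg.monic, hg.aeval_eq_zero⟩

theorem isIntegral_base (hg : P.IsGenerator y φ) : IsIntegral F y := hg.isIntegral.tower_top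

theorem dvd_of_aeval_eq_zero (hg : P.IsGenerator y φ) {D : P.ring[X]} (hD : aeval y D = 0) :
    φ ∣ D := by
  rw [← map_dvd_map _ (IsFractionRing.injective P.ring F) hg.monic, hg.map_eq]
  apply minpoly.dvd
  rwa [aeval_map_algebraMap]

theorem natDegree_minpoly (hg : P.IsGenerator y φ) : (minpoly F y).natDegree = φ.natDegree := by
  rw [← hg.map_eq, hg.monic.natDegree_map]

theorem finrank_eq (hg : P.IsGenerator y φ) : Module.finrank F E = φ.natDegree := by
  rw [← hg.natDegree_minpoly, ← IntermediateField.adjoin.finrank hg.isIntegral_base,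
    hg.adjoin_eq_top, IntermediateField.finrank_top']

theorem natDegree_pos (hg : P.IsGenerator y φ) : 0 < φ.natDegree := by
  rw [← hg.natDegree_minpoly]
  exact minpoly.natDegree_pos hg.isIntegral_base

/-- The normal form behind all later computations: a scalar from `F` times a primitive polynomial in
`y` of degree below `[E : F]`. -/
theorem exists_eq_mul_aeval (hg : P.IsGenerator y φ) {x : E} (hx : x ≠ 0) :
    ∃ (c : F) (D : P.ring[X]), c ≠ 0 ∧ D.natDegree < φ.natDegree ∧
      D.map (IsLocalRing.residue P.ring) ≠ 0 ∧ x = algebraMap F E c * aeval y D := by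
  have hmem : x ∈ IntermediateField.adjoin F {y} := hg.adjoin_eq_top ▸ IntermediateField.mem_top
  rw [← IntermediateField.mem_toSubalgebra, IntermediateField.adjoin_simple_toSubalgebra_of_isAlgebraic
    hg.isIntegral_base.isAlgebraic, Algebra.adjoin_singleton_eq_range_aeval] at hmem
  obtain ⟨G₀, hG₀⟩ := hmem
  have hG₀ : aeval y G₀ = x := hG₀
  set G := G₀ %ₘ minpoly F y
  have hmonic := minpoly.monic hg.isIntegral_base
  have hG : aeval y G = x := by
    rw [← hG₀, aeval_modByMonic_eq_self_of_root (minpoly.aeval F y)]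
  have hG0 : G ≠ 0 := by
    rintro h0
    rw [h0, map_zero] at hG
    exact hx hG.symm
  obtain ⟨c, D, hc, hGD, hD⟩ := P.ring.exists_eq_C_mul_map hG0
  refine ⟨c, D, hc, ?_, hD, ?_⟩
  · have h1 : G.natDegree < (minpoly F y).natDegree :=
      natDegree_modByMonic_lt _ hmonic (minpoly.ne_one F y)
    rwa [hg.natDegree_minpoly, hGD, natDegree_C_mul hc,
      natDegree_map_eq_of_injective (IsFractionRing.injective P.ring F)] at h1
  · rw [← hG, hGD, map_mul, aeval_C, aeval_map_algebraMap]

variable [Algebra K E]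

theorem mem_of_liesOver (hg : P.IsGenerator y φ) {Q : Place K E} (h : Q.LiesOver P) :
    y ∈ Q.ring := h.mem_of_isIntegral hg.isIntegral

theorem eval₂_residue_eq_zero (hg : P.IsGenerator y φ) {Q : Place K E} (h : Q.LiesOver P) :
    (φ.map (IsLocalRing.residue P.ring)).eval₂ h.residueMap
      (IsLocalRing.residue Q.ring ⟨y, hg.mem_of_liesOver h⟩) = 0 := by
  rw [← h.residue_aeval (hg.mem_of_liesOver h), IsLocalRing.residue_eq_zero_iff,
    ← ValuationSubring.coe_mem_nonunits_iff]
  simp only [hg.aeval_eq_zero]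
  exact Q.ring.nonunits.zero_mem

theorem exists_isCenteredAt [IsScalarTower K F E] (hg : P.IsGenerator y φ) {p : P.residueField[X]}
    (hp : Irreducible p) (hpφ : p ∣ φ.map (IsLocalRing.residue P.ring)) :
    ∃ (Q : Place K E) (h : Q.LiesOver P), h.IsCenteredAt y p := by
  refine P.exists_isCenteredAt hp fun D hD => hpφ.trans ?_
  obtain ⟨D', rfl⟩ := hg.dvd_of_aeval_eq_zero hD
  rw [Polynomial.map_mul]
  exact dvd_mul_right _ _

/-! ### A simple irreducible factor of the reduction -/

section Unramified

variable {p q : P.residueField[X]} {Q : Place K E} {h : Q.LiesOver P}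

theorem valuation_aeval_eq_one (hc : h.IsCenteredAt y p) {D : P.ring[X]}
    (hD : ¬ p ∣ D.map (IsLocalRing.residue P.ring)) : Q.ring.valuation (aeval y D) = 1 := by
  obtain ⟨h1, h2⟩ := hc D
  rw [← h2, ValuationSubring.mem_nonunits_iff, not_lt] at hD
  exact le_antisymm ((Q.ring.valuation_le_one_iff _).2 h1) hD

/-- Up to a unit at `Q`, every element of `E` comes from `F`, so `Q` is unramified. The triple `d,
b, c` is constrained only through `p`, so it serves every place centred at `p`; hence the uniqueness
in `eq_of_isCenteredAt`. -/
theorem exists_mul_eq_mul_aeval [IsDiscreteValuationRing P.ring] (hg : P.IsGenerator y φ)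
    (hp : Prime p) (hpq : φ.map (IsLocalRing.residue P.ring) = p * q) (hq : ¬ p ∣ q)
    (hc : h.IsCenteredAt y p) {x : E} (hx : x ≠ 0) :
    ∃ (d : F) (b c : P.ring[X]), ¬ p ∣ b.map (IsLocalRing.residue P.ring) ∧
      ¬ p ∣ c.map (IsLocalRing.residue P.ring) ∧
      aeval y c * x = algebraMap F E d * aeval y b := by
  obtain ⟨t, ht⟩ := IsDiscreteValuationRing.exists_irreducible P.ring
  obtain ⟨d, D, hd, -, -, hxD⟩ := hg.exists_eq_mul_aeval hx
  have hDy : aeval y D ≠ 0 := fun h0 => hx (by rw [hxD, h0, mul_zero])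
  by_contra! hcon
  -- otherwise every power of `t` divides `D(y)` up to units at `Q`
  have hdiv : ∀ n : ℕ, ∃ b c : P.ring[X], ¬ p ∣ c.map (IsLocalRing.residue P.ring) ∧
      aeval y c * aeval y D = algebraMap F E t ^ n * aeval y b := by
    intro n
    induction n with
    | zero => exact ⟨D, 1, by simpa using fun h => hp.not_isUnit (isUnit_of_dvd_one h), by simp⟩
    | succ n ih =>
      obtain ⟨b, c, hcp, hbc⟩ := ih
      have hb : p ∣ b.map (IsLocalRing.residue P.ring) := by
        by_contra hb
        refine hcon (d * t ^ n) b c hb hcp ?_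
        rw [hxD, mul_left_comm, hbc, map_mul, map_pow, mul_assoc]
      obtain ⟨s, hs⟩ := hb
      obtain ⟨s', rfl⟩ := map_surjective _ IsLocalRing.residue_surjective s
      obtain ⟨q', rfl⟩ := map_surjective _ IsLocalRing.residue_surjective q
      -- If `p` divides the reduction of `b`, then `q' * b` agrees with a multiple of `φ` modulo
      -- `t`; at `y` this extracts a factor `t` at the cost of `q'(y)`, a unit at `Q`.
      obtain ⟨b', hb'⟩ := IsDiscreteValuationRing.exists_eq_C_mul_of_map_residue_eq_zero ht
        (D := q' * b - φ * s') (by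
          rw [Polynomial.map_sub, Polynomial.map_mul, Polynomial.map_mul, hs, hpq]; ring)
      refine ⟨b', q' * c, ?_, ?_⟩
      · rw [Polynomial.map_mul]
        exact fun hdvd => (hp.dvd_or_dvd hdvd).elim hq hcp
      · have := congrArg (aeval y) hb'
        rw [map_sub, map_mul, map_mul, hg.aeval_eq_zero, zero_mul, sub_zero, map_mul, aeval_C] at this
        have ht' : algebraMap P.ring E t = algebraMap F E t := rfl
        rw [map_mul, mul_assoc, hbc, mul_left_comm, this, ht', pow_succ]
        ring
  -- The normal form of `1 / D(y)` bounds the power of `t` dividing `D(y)`: for large `N` the unit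
  -- `c(y)` would have valuation below 1.
  obtain ⟨r, D', hr, -, -, hrD⟩ := hg.exists_eq_mul_aeval (inv_ne_zero hDy)
  have htv : P.ring.valuation t < 1 := by
    rw [← ValuationSubring.valuation_lt_one_iff, ht.maximalIdeal_eq]
    exact Ideal.mem_span_singleton_self t
  obtain ⟨N, hN⟩ := P.ring.exists_pow_valuation_lt htv (inv_ne_zero hr)
  obtain ⟨b, c, hcp, hbc⟩ := hdiv N
  have hmem : r * (t : F) ^ N ∈ P.ring.nonunits := by
    have := hN N le_rfl
    have hr0 : 0 < P.ring.valuation r := by simpa [zero_lt_iff] using hr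
    rw [ValuationSubring.mem_nonunits_iff, map_mul, map_pow, ← mul_inv_cancel₀ hr0.ne', ← map_inv₀]
    exact mul_lt_mul_of_pos_left this hr0
  rw [← h.algebraMap_mem_nonunits_iff, ValuationSubring.mem_nonunits_iff, map_mul, map_pow] at hmem
  have h1 : aeval y c = algebraMap F E r * algebraMap F E t ^ N * (aeval y b * aeval y D') := by
    have h2 : aeval y c = (aeval y c * aeval y D) * (aeval y D)⁻¹ := by
      rw [mul_assoc, mul_inv_cancel₀ hDy, mul_one]
    rw [h2, hbc, hrD]
    ring
  have h3 := valuation_aeval_eq_one hc hcp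
  rw [h1, map_mul] at h3
  have h4 : Q.ring.valuation (aeval y b * aeval y D') ≤ 1 := by
    rw [ValuationSubring.valuation_le_one_iff]
    exact Q.ring.mul_mem _ _ (hc b).1 (hc D').1
  exact absurd h3 (mul_lt_one_of_lt_of_le hmem h4).ne

theorem mem_iff_of_mul_eq (hc : h.IsCenteredAt y p) {x : E} {d : F} {b c : P.ring[X]}
    (hb : ¬ p ∣ b.map (IsLocalRing.residue P.ring))
    (hcp : ¬ p ∣ c.map (IsLocalRing.residue P.ring))
    (hx : aeval y c * x = algebraMap F E d * aeval y b) : x ∈ Q.ring ↔ d ∈ P.ring := by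
  rw [← h.mem_iff, ← ValuationSubring.valuation_le_one_iff, ← ValuationSubring.valuation_le_one_iff]
  have := congrArg Q.ring.valuation hx
  rw [map_mul, map_mul, valuation_aeval_eq_one hc hb, valuation_aeval_eq_one hc hcp, one_mul,
    mul_one] at this
  rw [this]

theorem eq_of_isCenteredAt [IsDiscreteValuationRing P.ring] (hg : P.IsGenerator y φ)
    (hp : Prime p) (hpq : φ.map (IsLocalRing.residue P.ring) = p * q) (hq : ¬ p ∣ q)
    (hc : h.IsCenteredAt y p) {Q' : Place K E} {h' : Q'.LiesOver P} (hc' : h'.IsCenteredAt y p) :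
    Q' = Q := by
  ext x
  by_cases hx : x = 0
  · rw [hx]
    exact iff_of_true (ValuationSubring.zero_mem _) (ValuationSubring.zero_mem _)
  obtain ⟨d, b, c, hb, hcp, hxd⟩ := hg.exists_mul_eq_mul_aeval hp hpq hq hc hx
  rw [mem_iff_of_mul_eq hc hb hcp hxd, mem_iff_of_mul_eq hc' hb hcp hxd]

/-- The residue `η` of `y` has minimal polynomial `p`, and it generates `k(Q)` because an integral
`x` equals `d * b(y) / c(y)` with `d ∈ 𝒪_P` and `c(y)` a unit. -/
theorem relDegree_eq [IsDiscreteValuationRing P.ring] (hg : P.IsGenerator y φ)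
    (hp : Prime p) (hpm : p.Monic) (hpq : φ.map (IsLocalRing.residue P.ring) = p * q)
    (hq : ¬ p ∣ q) (hc : h.IsCenteredAt y p) : h.relDegree = p.natDegree := by
  have hy : y ∈ Q.ring := hg.mem_of_liesOver h
  let : Algebra P.residueField Q.residueField := h.residueMap.toAlgebra
  set η := IsLocalRing.residue Q.ring ⟨y, hy⟩
  have hη : aeval η p = 0 := (h.isCenteredAt_iff hy hp.irreducible).1 hc
  have hmin : minpoly P.residueField η = p :=
    (minpoly.eq_of_irreducible_of_monic hp.irreducible hη hpm).symm
  have hint : IsIntegral P.residueField η := ⟨p, hpm, hη⟩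
  have hres : ∀ D : P.ring[X], IsLocalRing.residue Q.ring ⟨aeval y D, h.aeval_mem hy D⟩ ∈
      IntermediateField.adjoin P.residueField {η} := by
    intro D
    rw [h.residue_aeval hy]
    change aeval η _ ∈ _
    exact IntermediateField.algebra_adjoin_le_adjoin _ _ (aeval_mem_adjoin_singleton _ _)
  have htop : IntermediateField.adjoin P.residueField {η} = ⊤ := by
    rw [eq_top_iff]
    rintro z -
    obtain ⟨⟨x, hxQ⟩, rfl⟩ := IsLocalRing.residue_surjective z
    by_cases hx : x = 0
    · subst hx
      rw [show (⟨0, hxQ⟩ : Q.ring) = 0 from rfl, map_zero]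
      exact zero_mem _
    obtain ⟨d, b, c, hb, hcp, hxd⟩ := hg.exists_mul_eq_mul_aeval hp hpq hq hc hx
    have hd : d ∈ P.ring := (mem_iff_of_mul_eq hc hb hcp hxd).1 hxQ
    have h1 : (⟨aeval y c, h.aeval_mem hy c⟩ : Q.ring) * ⟨x, hxQ⟩ =
        ⟨aeval y (C (⟨d, hd⟩ : P.ring) * b), h.aeval_mem hy _⟩ := by
      apply Subtype.ext
      change aeval y c * x = aeval y (C (⟨d, hd⟩ : P.ring) * b)
      rw [hxd, map_mul, aeval_C]
      rfl
    have h2 := congrArg (IsLocalRing.residue Q.ring) h1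
    rw [map_mul] at h2
    have h3 : IsLocalRing.residue Q.ring ⟨aeval y c, h.aeval_mem hy c⟩ ≠ 0 := by
      rw [Ne, IsLocalRing.residue_eq_zero_iff, ← ValuationSubring.coe_mem_nonunits_iff]
      exact fun h0 => hcp ((hc c).2.1 h0)
    rw [eq_div_of_mul_eq h3 ((mul_comm _ _).trans h2)]
    exact div_mem (hres _) (hres _)
  change Module.finrank P.residueField Q.residueField = _
  rw [← hmin, ← IntermediateField.adjoin.finrank hint, htop, IntermediateField.finrank_top']

end Unramified

end IsGenerator

end Place

/-! ### Squarefree reduction: decomposition and integral basis -/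

namespace Place.IsGenerator

variable {K F E : Type*} [Field K] [Field F] [Field E] [Algebra K F] [Algebra F E] [Algebra K E]
  {P : Place K F} {y : E} {φ : P.ring[X]}

section Unramified

variable {N : Finset ℕ} {p : ℕ → P.residueField[X]}

/-- Associated polynomials have equal degrees, so the distinctness of the elements of `N` makes the
reduction squarefree. -/
theorem not_dvd_prod_erase (hp : ∀ f ∈ N, Irreducible (p f)) (hdeg : ∀ f ∈ N, (p f).natDegree = f)
    {f : ℕ} (hf : f ∈ N) : ¬ p f ∣ ∏ g ∈ N.erase f, p g := by
  rw [(hp f hf).prime.dvd_finsetProd_iff]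
  rintro ⟨g, hg, hdvd⟩
  have hgN := Finset.mem_of_mem_erase hg
  have := natDegree_eq_of_degree_eq (degree_eq_degree_of_associated
    ((hp f hf).associated_of_dvd (hp g hgN) hdvd))
  rw [hdeg f hf, hdeg g hgN] at this
  exact Finset.ne_of_mem_erase hg this.symm

theorem existsUnique_relDegree_eq [IsScalarTower K F E] [IsDiscreteValuationRing P.ring] (hg : P.IsGenerator y φ)
    (hp : ∀ f ∈ N, Irreducible (p f)) (hpm : ∀ f ∈ N, (p f).Monic)
    (hdeg : ∀ f ∈ N, (p f).natDegree = f)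
    (hφ : φ.map (IsLocalRing.residue P.ring) = ∏ f ∈ N, p f) {f : ℕ} (hf : f ∈ N) :
    ∃! Q : Place K E, ∃ h : Q.LiesOver P, h.relDegree = f := by
  have hfac : ∀ g ∈ N, φ.map (IsLocalRing.residue P.ring) = p g * ∏ g' ∈ N.erase g, p g' :=
    fun g hgN => by rw [hφ, Finset.mul_prod_erase N p hgN]
  have hrel : ∀ g ∈ N, ∀ (Q : Place K E) (h : Q.LiesOver P), h.IsCenteredAt y (p g) →
      h.relDegree = g := fun g hgN Q h hc => by
    rw [hg.relDegree_eq (hp g hgN).prime (hpm g hgN) (hfac g hgN)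
      (not_dvd_prod_erase hp hdeg hgN) hc, hdeg g hgN]
  obtain ⟨Q, h, hc⟩ := hg.exists_isCenteredAt (hp f hf) (by rw [hfac f hf]; exact dvd_mul_right _ _)
  refine ⟨Q, ⟨h, hrel f hf Q h hc⟩, ?_⟩
  rintro Q' ⟨h', hf'⟩
  -- At any place above `P` the residue of `y` is a root of some factor `p g`; the relative degree
  -- then forces `g = f`.
  have h0 := hg.eval₂_residue_eq_zero h'
  rw [hφ, eval₂_finsetProd, Finset.prod_eq_zero_iff] at h0
  obtain ⟨g, hgN, hg0⟩ := h0
  have hc' := (h'.isCenteredAt_iff (hg.mem_of_liesOver h') (hp g hgN)).2 hg0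
  obtain rfl : g = f := (hrel g hgN Q' h' hc').symm.trans hf'
  exact hg.eq_of_isCenteredAt (hp g hf).prime (hfac g hf) (not_dvd_prod_erase hp hdeg hf) hc hc'

theorem isIntegralBasisAt [IsScalarTower K F E] (hg : P.IsGenerator y φ)
    (hp : ∀ f ∈ N, Irreducible (p f)) (hdeg : ∀ f ∈ N, (p f).natDegree = f)
    (hφ : φ.map (IsLocalRing.residue P.ring) = ∏ f ∈ N, p f) {m : ℕ} (hm : φ.natDegree = m) :
    P.IsIntegralBasisAt (fun i : Fin m => y ^ (i : ℕ)) := by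
  have hli : LinearIndependent F (fun i : Fin m => y ^ (i : ℕ)) := by
    have := linearIndependent_pow (K := F) y
    rwa [hg.natDegree_minpoly, hm] at this
  refine ⟨hli, ?_, le_antisymm ?_ ?_⟩
  · have := hg.finrank_eq
    have : FiniteDimensional F E :=
      Module.finite_of_finrank_pos (by rw [this]; exact hg.natDegree_pos)
    exact hli.span_eq_top_of_card_eq_finrank' (by rw [Fintype.card_fin, hg.finrank_eq, hm])
  · rw [Submodule.span_le]
    rintro _ ⟨i, rfl⟩
    exact hg.isIntegral.pow _
  intro x hx
  have hx : IsIntegral P.ring x := hx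
  by_cases hx0 : x = 0
  · rw [hx0]; exact zero_mem _
  obtain ⟨c, D, hc, hDdeg, hD, rfl⟩ := hg.exists_eq_mul_aeval hx0
  by_cases hcP : c ∈ P.ring
  · rw [aeval_eq_sum_range' (hm ▸ hDdeg), Finset.mul_sum, Finset.sum_range]
    refine sum_mem fun i _ => ?_
    have : algebraMap F E c * D.coeff i • y ^ (i : ℕ) =
        ((⟨c, hcP⟩ : P.ring) * D.coeff i) • y ^ (i : ℕ) := by
      rw [Algebra.smul_def, Algebra.smul_def, map_mul, mul_assoc]
      rfl
    rw [this]
    exact Submodule.smul_mem _ _ (Submodule.subset_span ⟨i, rfl⟩)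
  · exfalso
    have hcinv : c⁻¹ ∈ P.ring.nonunits := (ValuationSubring.inv_mem_nonunits_iff _).2 (Or.inr hcP)
    -- If `c` is not integral, then `D(y) = c⁻¹ * x` is a nonunit at the place of every factor. All
    -- factors, hence their product of degree `m`, divide the nonzero reduction of `D`, whose degree
    -- is less than `m`.
    have hdvd : ∀ f ∈ N, p f ∣ D.map (IsLocalRing.residue P.ring) := by
      intro f hf
      obtain ⟨Q, h, hcen⟩ := hg.exists_isCenteredAt (hp f hf)
        (by rw [hφ]; exact Finset.dvd_prod_of_mem p hf)
      rw [← (hcen D).2]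
      have h1 : aeval y D = algebraMap F E c⁻¹ * (algebraMap F E c * aeval y D) := by
        rw [← mul_assoc, ← map_mul, inv_mul_cancel₀ hc, map_one, one_mul]
      rw [h1, ValuationSubring.mem_nonunits_iff, map_mul]
      refine mul_lt_one_of_lt_of_le ?_ ?_
      · rwa [← ValuationSubring.mem_nonunits_iff, h.algebraMap_mem_nonunits_iff]
      · rw [ValuationSubring.valuation_le_one_iff]
        exact h.mem_of_isIntegral hx
    have hprod : ∏ f ∈ N, p f ∣ D.map (IsLocalRing.residue P.ring) := by
      refine Finset.prod_dvd_of_coprime (fun f hf g hgN hne => ?_) hdvd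
      refine (hp f hf).coprime_iff_not_dvd.2 fun hfg => ?_
      exact not_dvd_prod_erase hp hdeg hf
        (hfg.trans (Finset.dvd_prod_of_mem p (Finset.mem_erase.2 ⟨hne.symm, hgN⟩)))
    rw [← hφ] at hprod
    have h1 := natDegree_le_of_dvd hprod hD
    rw [hg.monic.natDegree_map] at h1
    exact absurd (h1.trans natDegree_map_le) (not_le.2 hDdeg)

end Unramified

/-! ### Eisenstein polynomials and total ramification -/

section TotallyRamified

theorem isCenteredAt_X (hg : P.IsGenerator y φ)
    (hφ : φ.map (IsLocalRing.residue P.ring) = X ^ φ.natDegree) {Q : Place K E}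
    (h : Q.LiesOver P) : h.IsCenteredAt y X := by
  rw [h.isCenteredAt_iff (hg.mem_of_liesOver h) irreducible_X, eval₂_X]
  have h0 := hg.eval₂_residue_eq_zero h
  rw [hφ, eval₂_X_pow] at h0
  exact eq_zero_of_pow_eq_zero h0

theorem valuation_generator_lt_one (hg : P.IsGenerator y φ)
    (hφ : φ.map (IsLocalRing.residue P.ring) = X ^ φ.natDegree) {Q : Place K E}
    (h : Q.LiesOver P) : Q.ring.valuation y < 1 := by
  have := (hg.isCenteredAt_X hφ h X).2
  rw [aeval_X, map_X] at this
  exact this.2 dvd_rfl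

variable [IsDiscreteValuationRing P.ring]

/-- Writing `φ = X ^ m + t * ψ` gives `y ^ m = -t * ψ(y)`, and `ψ(y)` is a unit because `t ^ 2` does
not divide `φ.coeff 0`. -/
theorem valuation_uniformizer (hg : P.IsGenerator y φ)
    (hφ : φ.map (IsLocalRing.residue P.ring) = X ^ φ.natDegree)
    (hφ0 : φ.coeff 0 ∉ IsLocalRing.maximalIdeal P.ring ^ 2) {t : P.ring} (ht : Irreducible t)
    {Q : Place K E} (h : Q.LiesOver P) :
    Q.ring.valuation (algebraMap F E t) = Q.ring.valuation y ^ φ.natDegree := by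
  obtain ⟨ψ, hψ⟩ := IsDiscreteValuationRing.exists_eq_C_mul_of_map_residue_eq_zero ht
    (D := φ - X ^ φ.natDegree) (by simp [hφ])
  have hψ0 : ¬ X ∣ ψ.map (IsLocalRing.residue P.ring) := by
    rw [X_dvd_iff, coeff_map, IsLocalRing.residue_eq_zero_iff, ht.maximalIdeal_eq,
      Ideal.mem_span_singleton]
    rintro ⟨s, hs⟩
    apply hφ0
    have h1 := congrArg (fun r => r.coeff 0) hψ
    simp only [coeff_sub, coeff_C_mul, coeff_X_pow, hg.natDegree_pos.ne, if_false, sub_zero,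
      hs] at h1
    rw [h1, ht.maximalIdeal_eq, Ideal.span_singleton_pow, Ideal.mem_span_singleton]
    exact ⟨s, by ring⟩
  have h1 := congrArg (aeval y) hψ
  rw [map_sub, hg.aeval_eq_zero, map_pow, aeval_X, map_mul, aeval_C, zero_sub] at h1
  have h2 := congrArg Q.ring.valuation h1
  rw [Valuation.map_neg, map_mul, map_pow, valuation_aeval_eq_one (hg.isCenteredAt_X hφ h) hψ0,
    mul_one] at h2
  exact h2.symm

theorem valuation_generator_pos (hg : P.IsGenerator y φ)
    (hφ : φ.map (IsLocalRing.residue P.ring) = X ^ φ.natDegree)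
    (hφ0 : φ.coeff 0 ∉ IsLocalRing.maximalIdeal P.ring ^ 2) {Q : Place K E} (h : Q.LiesOver P) :
    0 < Q.ring.valuation y := by
  obtain ⟨t, ht⟩ := IsDiscreteValuationRing.exists_irreducible P.ring
  have hvt := hg.valuation_uniformizer hφ hφ0 ht h
  rw [zero_lt_iff]
  intro h0
  rw [h0, zero_pow hg.natDegree_pos.ne', Valuation.zero_iff, map_eq_zero] at hvt
  exact ht.ne_zero (Subtype.ext hvt)

/-- The reduction of `D` is `X ^ i * r` with `X ∤ r` and `i < φ.natDegree`, so `D(y)` has the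
valuation of `y ^ i`, larger than that of `t`, and cannot compensate a pole of `c`. The criterion
does not mention `Q`, so only one place lies above `P`. -/
theorem mem_iff_of_eisenstein (hg : P.IsGenerator y φ)
    (hφ : φ.map (IsLocalRing.residue P.ring) = X ^ φ.natDegree)
    (hφ0 : φ.coeff 0 ∉ IsLocalRing.maximalIdeal P.ring ^ 2) {Q : Place K E} (h : Q.LiesOver P)
    {c : F} {D : P.ring[X]} (hc : c ≠ 0) (hDdeg : D.natDegree < φ.natDegree)
    (hD : D.map (IsLocalRing.residue P.ring) ≠ 0) :
    algebraMap F E c * aeval y D ∈ Q.ring ↔ c ∈ P.ring := by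
  have hcen := hg.isCenteredAt_X hφ h
  refine ⟨fun hx => ?_, fun hcP => Q.ring.mul_mem _ _ ((h.mem_iff c).2 hcP) (hcen D).1⟩
  by_contra hcP
  obtain ⟨t, ht⟩ := IsDiscreteValuationRing.exists_irreducible P.ring
  have hvt := hg.valuation_uniformizer hφ hφ0 ht h
  have hvy := hg.valuation_generator_lt_one hφ h
  have hcinv : c⁻¹ ∈ P.ring.nonunits := (ValuationSubring.inv_mem_nonunits_iff _).2 (Or.inr hcP)
  obtain ⟨s, hs⟩ : ∃ s : P.ring, c⁻¹ = t * s := by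
    obtain ⟨hmem, hmax⟩ := ValuationSubring.mem_nonunits_iff_exists_mem_maximalIdeal.1 hcinv
    rw [ht.maximalIdeal_eq, Ideal.mem_span_singleton] at hmax
    obtain ⟨s, hs⟩ := hmax
    exact ⟨s, congrArg Subtype.val hs⟩
  have hDle : Q.ring.valuation (aeval y D) ≤ Q.ring.valuation y ^ φ.natDegree := by
    have h1 : aeval y D = algebraMap F E t *
        (algebraMap F E s * (algebraMap F E c * aeval y D)) := by
      rw [← mul_assoc, ← mul_assoc, ← map_mul, ← map_mul, ← hs, inv_mul_cancel₀ hc, map_one,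
        one_mul]
    rw [h1, map_mul, hvt]
    refine mul_le_of_le_one_right' ((Q.ring.valuation_le_one_iff _).2 ?_)
    exact Q.ring.mul_mem _ _ ((h.mem_iff _).2 s.2) hx
  obtain ⟨i, r, hr, hDr⟩ := WfDvdMonoid.max_power_factor hD irreducible_X
  obtain ⟨D₂, rfl⟩ := map_surjective _ IsLocalRing.residue_surjective r
  obtain ⟨D₁, hD₁⟩ := IsDiscreteValuationRing.exists_eq_C_mul_of_map_residue_eq_zero ht
    (D := D - X ^ i * D₂) (by simp [hDr])
  have hi : i < φ.natDegree := by
    have h1 : i ≤ (D.map (IsLocalRing.residue P.ring)).natDegree := by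
      have := natDegree_le_of_dvd (Dvd.intro _ hDr.symm) hD
      rwa [natDegree_X_pow] at this
    exact (h1.trans natDegree_map_le).trans_lt hDdeg
  have h1 : y ^ i * aeval y D₂ = aeval y D - algebraMap F E t * aeval y D₁ := by
    have := congrArg (aeval y) hD₁
    rw [map_sub, map_mul, map_mul, map_pow, aeval_X, aeval_C] at this
    rw [show algebraMap F E t = algebraMap P.ring E t from rfl, ← this, sub_sub_cancel]
  have h2 : Q.ring.valuation y ^ i ≤ Q.ring.valuation y ^ φ.natDegree := by
    have h3 := congrArg Q.ring.valuation h1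
    rw [map_mul, map_pow, valuation_aeval_eq_one hcen hr, mul_one] at h3
    rw [h3]
    refine Q.ring.valuation.map_sub_le hDle ?_
    rw [map_mul, hvt]
    exact mul_le_of_le_one_right' ((Q.ring.valuation_le_one_iff _).2 (hcen D₁).1)
  have hvy0 := hg.valuation_generator_pos hφ hφ0 h
  exact absurd h2 (not_le.2 (pow_lt_pow_right_of_lt_one₀ hvy0 hvy hi))

theorem isTotallyRamifiedIn [IsScalarTower K F E] (hg : P.IsGenerator y φ)
    (hφ : φ.map (IsLocalRing.residue P.ring) = X ^ φ.natDegree)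
    (hφ0 : φ.coeff 0 ∉ IsLocalRing.maximalIdeal P.ring ^ 2) : P.IsTotallyRamifiedIn E := by
  obtain ⟨t, ht⟩ := IsDiscreteValuationRing.exists_irreducible P.ring
  obtain ⟨Q, h, hcen⟩ := hg.exists_isCenteredAt irreducible_X
    (by rw [hφ]; exact dvd_pow_self X hg.natDegree_pos.ne')
  refine ⟨Q, h, fun Q' h' => ?_, ?_⟩
  · ext x
    by_cases hx : x = 0
    · rw [hx]
      exact iff_of_true (ValuationSubring.zero_mem _) (ValuationSubring.zero_mem _)
    obtain ⟨c, D, hc, hDdeg, hD, rfl⟩ := hg.exists_eq_mul_aeval hx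
    rw [hg.mem_iff_of_eisenstein hφ hφ0 h' hc hDdeg hD,
      hg.mem_iff_of_eisenstein hφ hφ0 h hc hDdeg hD]
  have hvt := hg.valuation_uniformizer hφ hφ0 ht h
  have hvy := hg.valuation_generator_lt_one hφ h
  have hy : y ∈ Q.ring := hg.mem_of_liesOver h
  have hvy0 := hg.valuation_generator_pos hφ hφ0 h
  have hmul : ∀ a : P.ring, a ∈ IsLocalRing.maximalIdeal P.ring →
      Q.ring.valuation (algebraMap F E a) ≤ Q.ring.valuation y := by
    intro a ha
    rw [ht.maximalIdeal_eq, Ideal.mem_span_singleton] at ha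
    obtain ⟨s, rfl⟩ := ha
    rw [MulMemClass.coe_mul, map_mul, map_mul, hvt]
    refine (mul_le_of_le_one_right' ((h.valuation_algebraMap_le_one_iff _).2 s.2)).trans ?_
    exact pow_le_of_le_one zero_le hvy.le hg.natDegree_pos.ne'
  -- `y` is a uniformizer at `Q`: in the normal form either the constant term of `D` is in the
  -- maximal ideal, or `D(y)` is a unit and `c` is a nonunit.
  have hle : ∀ x : E, Q.ring.valuation x < 1 → Q.ring.valuation x ≤ Q.ring.valuation y := by
    intro x hx
    by_cases hx0 : x = 0
    · rw [hx0, map_zero]; exact zero_le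
    obtain ⟨c, D, hc, hDdeg, hD, rfl⟩ := hg.exists_eq_mul_aeval hx0
    have hcP : c ∈ P.ring := (hg.mem_iff_of_eisenstein hφ hφ0 h hc hDdeg hD).1
      ((Q.ring.valuation_le_one_iff _).1 hx.le)
    have hc1 := (h.valuation_algebraMap_le_one_iff _).2 hcP
    have hD1 := (Q.ring.valuation_le_one_iff _).2 (hcen D).1
    rw [map_mul] at hx ⊢
    by_cases hDX : X ∣ D.map (IsLocalRing.residue P.ring)
    · refine (mul_le_of_le_one_left' hc1).trans ?_
      rw [X_dvd_iff, coeff_map, IsLocalRing.residue_eq_zero_iff] at hDX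
      rw [← divX_mul_X_add D, map_add, map_mul, aeval_X, aeval_C]
      refine Q.ring.valuation.map_add_le ?_ (hmul _ hDX)
      rw [map_mul]
      exact mul_le_of_le_one_left' ((Q.ring.valuation_le_one_iff _).2 (hcen _).1)
    · rw [valuation_aeval_eq_one hcen hDX, mul_one] at hx ⊢
      rw [← ValuationSubring.mem_nonunits_iff, h.algebraMap_mem_nonunits_iff] at hx
      exact hmul ⟨c, hcP⟩ (ValuationSubring.coe_mem_nonunits_iff.1 hx)
  have hmax : IsLocalRing.maximalIdeal Q.ring = Ideal.span {⟨y, hy⟩} := by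
    apply le_antisymm
    · intro x hx
      obtain ⟨a, ha⟩ := (Q.ring.valuation_le_iff _ _).1
        (hle x ((Q.ring.valuation_lt_one_iff x).1 hx))
      rw [Ideal.mem_span_singleton]
      exact ⟨a, Subtype.ext (ha.symm.trans (mul_comm _ _))⟩
    · rw [Ideal.span_singleton_le_iff_mem, ValuationSubring.valuation_lt_one_iff]
      exact hvy
  -- The set is bounded, so `sSup` is a true maximum and not the default value 0.
  have hset : {n : ℕ | (IsLocalRing.maximalIdeal P.ring).map h.ringMap ≤
      IsLocalRing.maximalIdeal Q.ring ^ n} = Set.Iic φ.natDegree := by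
    ext n
    rw [Set.mem_ofPred_eq, Set.mem_Iic, hmax, ht.maximalIdeal_eq, Ideal.map_span,
      Set.image_singleton, Ideal.span_singleton_pow, Ideal.span_singleton_le_span_singleton]
    rw [← pow_le_pow_iff_right_of_lt_one₀ hvy0 hvy, ← hvt, ← map_pow,
      ValuationSubring.valuation_le_iff]
    constructor
    · rintro ⟨a, ha⟩
      refine ⟨a, ?_⟩
      have := congrArg Subtype.val ha
      rw [mul_comm]
      exact this.symm
    · rintro ⟨a, ha⟩
      exact ⟨a, Subtype.ext (ha.symm.trans (mul_comm _ _))⟩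
  rw [LiesOver.ramificationIndex, hset, csSup_Iic, hg.finrank_eq]

end TotallyRamified

end Place.IsGenerator

/-! ### Irreducible polynomials over finite fields; monic polynomials with given coefficients -/

theorem FiniteField.exists_monic_irreducible_natDegree_eq (k : Type*) [Field k] [Finite k] {n : ℕ}
    (hn : 0 < n) : ∃ p : k[X], p.Monic ∧ Irreducible p ∧ p.natDegree = n := by
  obtain ⟨q, hq⟩ := CharP.exists k
  have : Fact q.Prime := ⟨CharP.char_is_prime k q⟩
  have : NeZero n := ⟨hn.ne'⟩
  obtain ⟨α, hα⟩ := Field.exists_primitive_element k (FiniteField.Extension k q n)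
  have hint : IsIntegral k α := Algebra.IsIntegral.isIntegral α
  refine ⟨minpoly k α, minpoly.monic hint, minpoly.irreducible hint, ?_⟩
  rw [← IntermediateField.adjoin.finrank hint, hα, IntermediateField.finrank_top',
    FiniteField.finrank_extension]

namespace Polynomial

variable {A B : Type*} [CommRing A] [CommRing B]

/-- The monic polynomial of degree `m` with lower coefficients `a 0, …, a (m - 1)`. -/
noncomputable def monicOfCoeff (m : ℕ) (a : ℕ → A) : A[X] :=
  X ^ m + ∑ i ∈ Finset.range m, C (a i) * X ^ i

theorem degree_sum_range_C_mul_X_pow_lt (m : ℕ) (a : ℕ → A) :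
    (∑ i ∈ Finset.range m, C (a i) * X ^ i).degree < (m : WithBot ℕ) := by
  rw [degree_lt_iff_coeff_zero]
  intro i hi
  simp [finsetSum_coeff, coeff_C_mul, coeff_X_pow, hi]

theorem monic_monicOfCoeff (m : ℕ) (a : ℕ → A) : (monicOfCoeff m a).Monic :=
  monic_X_pow_add (degree_sum_range_C_mul_X_pow_lt m a)

theorem natDegree_monicOfCoeff [Nontrivial A] (m : ℕ) (a : ℕ → A) :
    (monicOfCoeff m a).natDegree = m := by
  apply natDegree_eq_of_degree_eq_some
  rw [monicOfCoeff, degree_add_eq_left_of_degree_lt, degree_X_pow]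
  rw [degree_X_pow]
  exact degree_sum_range_C_mul_X_pow_lt m a

theorem coeff_monicOfCoeff {m : ℕ} (a : ℕ → A) {i : ℕ} (hi : i < m) :
    (monicOfCoeff m a).coeff i = a i := by
  simp [monicOfCoeff, finsetSum_coeff, coeff_C_mul, coeff_X_pow, hi.ne, hi]

theorem map_monicOfCoeff (f : A →+* B) (m : ℕ) (a : ℕ → A) :
    (monicOfCoeff m a).map f = monicOfCoeff m fun i => f (a i) := by
  simp [monicOfCoeff, Polynomial.map_sum]

theorem monicOfCoeff_congr {m : ℕ} {a b : ℕ → A} (h : ∀ i < m, a i = b i) :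
    monicOfCoeff m a = monicOfCoeff m b := by
  rw [monicOfCoeff, monicOfCoeff]
  congr 1
  exact Finset.sum_congr rfl fun i hi => by rw [h i (Finset.mem_range.1 hi)]

theorem Monic.eq_monicOfCoeff {g : A[X]} (hg : g.Monic) {m : ℕ} (hm : g.natDegree = m) :
    g = monicOfCoeff m g.coeff := by
  subst hm
  exact hg.as_sum

theorem monicOfCoeff_zero (m : ℕ) : monicOfCoeff m (fun _ => (0 : A)) = X ^ m := by
  simp [monicOfCoeff]

end Polynomial

/-! ### Approximation at places -/

namespace Place

variable {K F : Type*} [Field K] [Field F] [Algebra K F]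

theorem ring_injective : Function.Injective (ring : Place K F → ValuationSubring F) :=
  fun _ _ h => Place.ext h

theorem exists_valuation_sub_lt (T : Finset (Place K F))
    (hT : ∀ P ∈ T, IsDiscreteValuationRing P.ring) (a c : Place K F → F)
    (hc : ∀ P ∈ T, c P ≠ 0) :
    ∃ x : F, ∀ P ∈ T, P.ring.valuation (x - a P) < P.ring.valuation (c P) := by
  classical
  obtain ⟨x, hx⟩ := ValuationSubring.exists_valuation_sub_lt (T.image ring)
    (by simpa using hT) (by simpa using fun P _ => P.ne_top) (Function.extend ring a 0)
    (Function.extend ring c 0) (by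
      intro A hA
      obtain ⟨P, hP, rfl⟩ := Finset.mem_image.1 hA
      rw [ring_injective.extend_apply]
      exact hc P hP)
  refine ⟨x, fun P hP => ?_⟩
  have := hx P.ring (Finset.mem_image_of_mem _ hP)
  rwa [ring_injective.extend_apply, ring_injective.extend_apply] at this

theorem exists_residue_eq_and_valuation_eq {S : Finset (Place K F)} {R : Place K F} (hR : R ∉ S)
    (hS : ∀ P ∈ S, IsDiscreteValuationRing P.ring) [IsDiscreteValuationRing R.ring]
    (a : ∀ P : Place K F, P.residueField) {t : F} (ht : t ≠ 0) :
    ∃ x : F, (∀ P ∈ S, ∃ hx : x ∈ P.ring, IsLocalRing.residue P.ring ⟨x, hx⟩ = a P) ∧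
      R.ring.valuation x = R.ring.valuation t := by
  classical
  choose b hb using fun P : Place K F => IsLocalRing.residue_surjective (a P)
  obtain ⟨x, hx⟩ := exists_valuation_sub_lt (insert R S)
    (fun P hP => (Finset.mem_insert.1 hP).elim (fun h => h ▸ inferInstance) (hS P))
    -- At `R` the error is strictly smaller than `t`, which fixes the valuation; at `S` precision 1
    -- fixes the residue.
    (fun P => if P = R then t else b P) (fun P => if P = R then t else 1)
    (fun P _ => by split_ifs <;> simp [ht])
  refine ⟨x, fun P hP => ?_, ?_⟩
  · have hne : P ≠ R := fun h => hR (h ▸ hP)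
    have h1 := hx P (Finset.mem_insert_of_mem hP)
    rw [if_neg hne, if_neg hne, map_one, ← ValuationSubring.mem_nonunits_iff] at h1
    have hxP : x ∈ P.ring := by
      have := P.ring.add_mem _ _ (P.ring.nonunits_subset h1) (b P).2
      rwa [sub_add_cancel] at this
    refine ⟨hxP, ?_⟩
    rw [← hb P, ← sub_eq_zero, ← map_sub, IsLocalRing.residue_eq_zero_iff,
      ← ValuationSubring.coe_mem_nonunits_iff]
    exact h1
  · have h1 := hx R (Finset.mem_insert_self _ _)
    rw [if_pos rfl, if_pos rfl] at h1
    have := R.ring.valuation.map_add_eq_of_lt_right h1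
    rwa [sub_add_cancel] at this

end Place

/-! ### The global polynomial and its root field -/

theorem proposition3p6 {Fq : Type*} {F : Type u} [Field Fq] [Finite Fq] [Field F] [Algebra Fq F]
    (hF : IsAlgFunctionField Fq F)
    (S : Finset (Place Fq F)) (R : Place Fq F) (hR : R ∉ S)
    (N : Place Fq F → Finset ℕ) (hN : ∀ P ∈ S, ∀ f ∈ N P, 0 < f)
    (m : ℕ) (hm : 0 < m) (hsum : ∀ P ∈ S, ∑ f ∈ N P, f = m) :
    ∃ (E : Type u) (_ : Field E) (_ : Algebra Fq E) (_ : Algebra F E) (_ : IsScalarTower Fq F E),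
      FiniteDimensional F E ∧ Algebra.IsSeparable F E ∧
      Module.finrank F E = m ∧ R.IsTotallyRamifiedIn E ∧
      (∀ P ∈ S, ∀ f ∈ N P, ∃! Q : Place Fq E, ∃ h : Q.LiesOver P, h.relDegree = f) ∧
      ∃ y : E, IntermediateField.adjoin F {y} = ⊤ ∧
        ∀ P ∈ S, P.IsIntegralBasisAt (fun i : Fin m => y ^ (i : ℕ)) := by
  have hdvr : ∀ P : Place Fq F, IsDiscreteValuationRing P.ring := fun P =>
    (hF.isDiscreteValuationRing_and_finite P).1
  have hfin : ∀ P : Place Fq F, Finite P.residueField := fun P =>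
    (hF.isDiscreteValuationRing_and_finite P).2
  have hp : ∀ (P : Place Fq F) (f : ℕ), ∃ p : P.residueField[X], 0 < f →
      p.Monic ∧ Irreducible p ∧ p.natDegree = f := by
    intro P f
    by_cases hf : 0 < f
    · obtain ⟨p, hp⟩ := FiniteField.exists_monic_irreducible_natDegree_eq P.residueField hf
      exact ⟨p, fun _ => hp⟩
    · exact ⟨0, fun h => absurd h hf⟩
  choose p hp using hp
  set g : ∀ P : Place Fq F, P.residueField[X] := fun P => ∏ f ∈ N P, p P f
  have hg : ∀ P ∈ S, (g P).Monic ∧ (g P).natDegree = m := by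
    intro P hP
    have h1 : ∀ f ∈ N P, (p P f).Monic := fun f hf => (hp P f (hN P hP f hf)).1
    refine ⟨monic_prod_of_monic _ _ h1, ?_⟩
    rw [natDegree_prod_of_monic _ _ h1, ← hsum P hP]
    exact Finset.sum_congr rfl fun f hf => (hp P f (hN P hP f hf)).2.2
  obtain ⟨t, ht⟩ := IsDiscreteValuationRing.exists_irreducible R.ring
  have ht0 : (t : F) ≠ 0 := fun h => ht.ne_zero (Subtype.ext h)
  -- Eisenstein needs the exact valuation of `t` only for `α 0`; imposing it on `α 1` too makes that
  -- coefficient nonzero, for separability.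
  choose α hαS hαR using fun i : ℕ => Place.exists_residue_eq_and_valuation_eq hR
    (fun P _ => hdvr P) (fun P => (g P).coeff i) ht0
  have htm : t ∈ IsLocalRing.maximalIdeal R.ring := by
    rw [ht.maximalIdeal_eq]; exact Ideal.mem_span_singleton_self t
  have htv : R.ring.valuation t < 1 := (R.ring.valuation_lt_one_iff t).1 htm
  have hαR_mem : ∀ i, α i ∈ R.ring := fun i => by
    rw [← R.ring.valuation_le_one_iff, hαR]; exact htv.le
  set Φ : F[X] := monicOfCoeff m α
  set φR : R.ring[X] := monicOfCoeff m fun i => ⟨α i, hαR_mem i⟩ with hφR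
  have hφR_map : φR.map (algebraMap R.ring F) = Φ := map_monicOfCoeff _ _ _
  have hφR_deg : φR.natDegree = m := natDegree_monicOfCoeff _ _
  have hφR_mem : ∀ i, (⟨α i, hαR_mem i⟩ : R.ring) ∈ IsLocalRing.maximalIdeal R.ring := fun i => by
    rw [R.ring.valuation_lt_one_iff]
    exact (hαR i).trans_lt htv
  have hφR0 : φR.coeff 0 ∉ IsLocalRing.maximalIdeal R.ring ^ 2 := by
    rw [coeff_monicOfCoeff _ hm, ht.maximalIdeal_eq, Ideal.span_singleton_pow,
      Ideal.mem_span_singleton]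
    rintro ⟨s, hs⟩
    have h1 : α 0 = (t : F) ^ 2 * s := congrArg Subtype.val hs
    have h2 := hαR 0
    have htv0 : 0 < R.ring.valuation (t : F) := by simpa [zero_lt_iff] using ht0
    rw [h1, map_mul, map_pow] at h2
    have h3 : R.ring.valuation (t : F) ^ 2 * R.ring.valuation (s : F) ≤
        R.ring.valuation (t : F) ^ 2 := mul_le_of_le_one_right' (R.ring.valuation_le_one s)
    rw [h2] at h3
    exact absurd h3 (not_le.2 (pow_lt_self_of_lt_one₀ htv0 htv one_lt_two))
  have hφR_irr : Irreducible φR := by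
    have hmonic : φR.Monic := monic_monicOfCoeff _ _
    refine (hmonic.isEisensteinAt_of_mem_of_notMem (Ideal.IsPrime.ne_top inferInstance)
      (fun {n} hn => ?_) hφR0).irreducible inferInstance hmonic.isPrimitive (by rwa [hφR_deg])
    rw [hφR_deg] at hn
    rw [coeff_monicOfCoeff _ hn]
    exact hφR_mem n
  have hΦm : Φ.Monic := monic_monicOfCoeff _ _
  have hΦirr : Irreducible Φ := by
    rw [← hφR_map]
    exact ((monic_monicOfCoeff _ _).irreducible_iff_irreducible_map_fraction_map).1 hφR_irr
  have hΦsep : Φ.Separable := by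
    rw [separable_iff_derivative_ne_zero hΦirr]
    intro h0
    have h1 := congrArg (fun r => r.coeff 0) h0
    simp only [coeff_derivative, coeff_zero, zero_add, Nat.cast_zero, mul_one] at h1
    -- The constant term of `Φ'` is the linear coefficient of `Φ`: it is `α 1` if `m > 1`, and the
    -- leading coefficient 1 if `m = 1`.
    rcases Nat.lt_or_ge 1 m with h | h
    · rw [coeff_monicOfCoeff _ h] at h1
      have h2 := hαR 1
      rw [h1, map_zero, eq_comm, Valuation.zero_iff] at h2
      exact ht0 h2
    · obtain rfl : m = 1 := by omega
      have h2 := hΦm.coeff_natDegree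
      rw [natDegree_monicOfCoeff, h1] at h2
      exact zero_ne_one h2
  have : Fact (Irreducible Φ) := ⟨hΦirr⟩
  set y := AdjoinRoot.root Φ
  have hmin : minpoly F y = Φ :=
    (minpoly.eq_of_irreducible_of_monic hΦirr (by simp [y]) hΦm).symm
  have hy : IntermediateField.adjoin F {y} = ⊤ := by
    rw [eq_top_iff]
    rintro x -
    exact IntermediateField.algebra_adjoin_le_adjoin F {y}
      (by rw [AdjoinRoot.adjoinRoot_eq_top]; exact Algebra.mem_top)
  have hgenR : R.IsGenerator y φR := ⟨monic_monicOfCoeff _ _, hφR_map.trans hmin.symm, hy⟩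
  have hgenS : ∀ P ∈ S, ∃ φ : P.ring[X], P.IsGenerator y φ ∧ φ.natDegree = m ∧
      φ.map (IsLocalRing.residue P.ring) = g P := by
    intro P hP
    choose hmem hres using fun i => hαS i P hP
    refine ⟨monicOfCoeff m fun i => ⟨α i, hmem i⟩, ⟨monic_monicOfCoeff _ _, ?_, hy⟩,
      natDegree_monicOfCoeff _ _, ?_⟩
    · rw [hmin]
      exact map_monicOfCoeff _ _ _
    · rw [map_monicOfCoeff, (hg P hP).1.eq_monicOfCoeff (hg P hP).2]
      exact monicOfCoeff_congr fun i _ => hres i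
  refine ⟨AdjoinRoot Φ, inferInstance, inferInstance, inferInstance, inferInstance,
    hΦm.finite_adjoinRoot, ?_, hgenR.finrank_eq.trans hφR_deg, ?_, ?_, y, hy, ?_⟩
  · have : Algebra.IsSeparable F (IntermediateField.adjoin F {y}) := by
      rw [IntermediateField.isSeparable_adjoin_simple_iff_isSeparable, IsSeparable, hmin]
      exact hΦsep
    rw [hy] at this
    exact Algebra.IsSeparable.of_algHom F _ (IntermediateField.topEquiv (F := F)).symm.toAlgHom
  · refine hgenR.isTotallyRamifiedIn ?_ hφR0
    rw [hφR_deg, hφR, map_monicOfCoeff, ← monicOfCoeff_zero]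
    exact monicOfCoeff_congr fun i _ => (IsLocalRing.residue_eq_zero_iff _).2 (hφR_mem i)
  · intro P hP f hf
    obtain ⟨φ, hφ, -, hres⟩ := hgenS P hP
    exact hφ.existsUnique_relDegree_eq (fun f hf => (hp P f (hN P hP f hf)).2.1)
      (fun f hf => (hp P f (hN P hP f hf)).1) (fun f hf => (hp P f (hN P hP f hf)).2.2) hres hf
  · intro P hP
    obtain ⟨φ, hφ, hdeg, hres⟩ := hgenS P hP
    exact hφ.isIntegralBasisAt (fun f hf => (hp P f (hN P hP f hf)).2.1)
      (fun f hf => (hp P f (hN P hP f hf)).2.2) hres hdeg
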